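/- Let $D$ be an infinite division ring (not necessarily commutative), let $n\ge 2$, and let $G=\mathrm{GL}_n(D)$. A subgroup $N$ of $G$ is called almost subnormal in $G$ if there is a finite series of subgroups $N=N_r\le N_{r-1}\le\cdots\le N_1\le N_0=G$ such that, for every $0\le i<r$, either $N_{i+1}$ is normal in $N_i$ or the index $[N_i:N_{i+1}]$ is finite. Let $\Gamma(G)$ be the intersection graph of $G$: its vertices are the non-trivial proper subgroups of $G$, and two distinct vertices $A,B$ are adjacent if and only if $A\cap B\ne 1$. Let $\Delta(G)$ be the subgraph of $\Gamma(G)$ induced on those vertices that are non-central (that is, not contained in the center of $G$) almost subnormal subgroups of $G$. Let $\mathrm{SL}_n(D)$ be the special linear group, that is, the subgroup of $G$ generated by all elementary transvections $I_n+c\,e_{ij}$ with $i\ne j$ and $c\in D$. Then: 1. the graph $\Delta(G)$ is complete, that is, any two distinct vertices of $\Delta(G)$ are adjacent; 2. a subgroup $N$ of $G$ is a vertex of $\Delta(G)$ if and only if $N$ is a proper non-central normal subgroup of $G$; 3. a subgroup $N$ of $G$ is a vertex of $\Delta(G)$ if and only if $N$ is a proper subgroup of $G$ containing $\mathrm{SL}_n(D)$.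 -/

import Mathlib

/-- `N` is almost subnormal in `G`: there is a descending series of subgroups
`N = H r ≤ ⋯ ≤ H 1 ≤ H 0 = G` such that each term is normal in the preceding one or has finite
index in it. -/
def IsAlmostSubnormal {G : Type*} [Group G] (N : Subgroup G) : Prop :=
  ∃ (r : ℕ) (H : ℕ → Subgroup G), H 0 = ⊤ ∧ H r = N ∧
    ∀ i < r, H (i + 1) ≤ H i ∧
      (((H (i + 1)).subgroupOf (H i)).Normal ∨ ((H (i + 1)).subgroupOf (H i)).FiniteIndex)

/-- The vertices of the intersection graph of `G`: the non-trivial proper subgroups. -/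
abbrev NontrivialProperSubgroup (G : Type*) [Group G] : Type _ :=
  {A : Subgroup G // A ≠ ⊥ ∧ A ≠ ⊤}

/-- The intersection graph `Γ(G)`: two distinct non-trivial proper subgroups are adjacent
when their intersection is non-trivial. -/
def intersectionGraph (G : Type*) [Group G] : SimpleGraph (NontrivialProperSubgroup G) where
  Adj A B := A ≠ B ∧ A.1 ⊓ B.1 ≠ ⊥
  symm := ⟨fun _ _ h => ⟨h.1.symm, by rw [inf_comm]; exact h.2⟩⟩
  loopless := ⟨fun _ h => h.1 rfl⟩

/-- The vertices of `Γ(G)` that are non-central almost subnormal subgroups of `G`. -/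
def deltaVerts (G : Type*) [Group G] : Set (NontrivialProperSubgroup G) :=
  {A | ¬ A.1 ≤ Subgroup.center G ∧ IsAlmostSubnormal A.1}

/-- The graph `Δ(G)`: the subgraph of `Γ(G)` induced on the non-central almost subnormal
subgroups of `G`. -/
def deltaGraph (G : Type*) [Group G] : SimpleGraph (deltaVerts G) :=
  (intersectionGraph G).induce (deltaVerts G)

/-- The vertex set of `Δ(G)`, as a set of subgroups of `G`. -/
def deltaVertexSet (G : Type*) [Group G] : Set (Subgroup G) :=
  Set.range fun v : deltaVerts G => v.1.1

/-- The special linear group `SL_n(D)` over a division ring (for `2 ≤ n`): the subgroup of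
`GL_n(D)` generated by the elementary transvections `1 + c e_{ij}`, `i ≠ j`. -/
def skewSL (n : ℕ) (D : Type*) [DivisionRing D] : Subgroup (Matrix.GeneralLinearGroup (Fin n) D) :=
  Subgroup.closure {g | ∃ (i j : Fin n) (c : D), i ≠ j ∧
    (g : Matrix (Fin n) (Fin n) D) = 1 + Matrix.single i j c}

/-! Everything reduces to one fact: a non-central almost subnormal subgroup contains `skewSL n D`.
Given that, two vertices meet in a non-trivial group, and every vertex is normal because `GL_n(D)`
is abelian modulo `skewSL n D`.

The core is `skewSL_le_of_normalized`, an Iwasawa-type argument. A non-central `K` normalised by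
`SL_n(D)` moves some line, hence by 2-transitivity carries any coordinate line to any other. So
every transvection agrees modulo `K` with one along a fixed line; these commute, so `K` contains all
commutators of `SL_n(D)`. Explicit commutators and the infinitude of `D` then yield all
transvections.

A finite-index step reduces to this case by passing to a normal core, which is non-central since `D`
is infinite. -/

section SkewLinearGroup

open Matrix

variable {D : Type*} [DivisionRing D] {n : ℕ}

/-! ### Transvections and diagonal matrices. -/

/-- The transvection `1 + c e_{ij}`, `i ≠ j`, as an element of `GL_n(D)`. -/
def transvectionUnit (i j : Fin n) (hij : i ≠ j) (c : D) : GeneralLinearGroup (Fin n) D where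
  val := 1 + single i j c
  inv := 1 + single i j (-c)
  val_inv := by
    simp [mul_add, add_mul, hij.symm, ← single_neg]
  inv_val := by
    simp [mul_add, add_mul, hij.symm, ← single_neg]

/-- Invertible diagonal matrices, as a homomorphism into `GL_n(D)`. -/
def diagonalUnit : (Fin n → Dˣ) →* GeneralLinearGroup (Fin n) D where
  toFun d :=
    { val := diagonal fun i => (d i : D)
      inv := diagonal fun i => ((d i)⁻¹ : Dˣ)
      val_inv := by simp
      inv_val := by simp }
  map_one' := by ext1; simp
  map_mul' d e := by ext1; simp

theorem GeneralLinearGroup.ext_mulVec {g h : GeneralLinearGroup (Fin n) D}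
    (H : ∀ v : Fin n → D, (g : Matrix (Fin n) (Fin n) D) *ᵥ v = (h : Matrix (Fin n) (Fin n) D) *ᵥ v) :
    g = h := by
  refine Units.ext (Matrix.ext fun i j => ?_)
  simpa using congrFun (H (Pi.single j 1)) i

theorem transvectionUnit_mulVec {i j : Fin n} (hij : i ≠ j) (c : D) (v : Fin n → D) :
    (transvectionUnit i j hij c : Matrix (Fin n) (Fin n) D) *ᵥ v =
      Function.update v i (v i + c * v j) := by
  ext k
  rcases eq_or_ne k i with rfl | hk
  · simp [transvectionUnit, mulVec, dotProduct, single_apply, add_mul, Finset.sum_add_distrib,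
      one_apply]
  · simp [transvectionUnit, mulVec, dotProduct, hk, hk.symm, one_apply]

theorem diagonalUnit_mulVec (d : Fin n → Dˣ) (v : Fin n → D) :
    (diagonalUnit d : Matrix (Fin n) (Fin n) D) *ᵥ v = fun k => (d k : D) * v k := by
  ext k
  simp [diagonalUnit, mulVec_diagonal]

theorem mul_mulVec_eq (g h : GeneralLinearGroup (Fin n) D) (v : Fin n → D) :
    ((g * h : GeneralLinearGroup (Fin n) D) : Matrix (Fin n) (Fin n) D) *ᵥ v =
      (g : Matrix (Fin n) (Fin n) D) *ᵥ ((h : Matrix (Fin n) (Fin n) D) *ᵥ v) := by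
  simp [mulVec_mulVec]

theorem transvectionUnit_add {i j : Fin n} (hij : i ≠ j) (c d : D) :
    transvectionUnit i j hij (c + d) = transvectionUnit i j hij c * transvectionUnit i j hij d := by
  refine GeneralLinearGroup.ext_mulVec fun v => ?_
  rw [mul_mulVec_eq]
  simp only [transvectionUnit_mulVec]
  simp [hij.symm]
  congr 1
  noncomm_ring

theorem transvectionUnit_zero {i j : Fin n} (hij : i ≠ j) :
    transvectionUnit i j hij (0 : D) = 1 := by
  ext1; simp [transvectionUnit]

theorem transvectionUnit_neg {i j : Fin n} (hij : i ≠ j) (c : D) :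
    transvectionUnit i j hij (-c) = (transvectionUnit i j hij c)⁻¹ :=
  Units.ext rfl

theorem transvectionUnit_mem_skewSL {i j : Fin n} (hij : i ≠ j) (c : D) :
    transvectionUnit i j hij c ∈ skewSL n D :=
  Subgroup.subset_closure ⟨i, j, c, hij, rfl⟩

theorem skewSL_le_iff {K : Subgroup (GeneralLinearGroup (Fin n) D)} :
    skewSL n D ≤ K ↔ ∀ (i j : Fin n) (hij : i ≠ j) (c : D), transvectionUnit i j hij c ∈ K := by
  refine ⟨fun h i j hij c => h (transvectionUnit_mem_skewSL hij c), fun h => ?_⟩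
  refine (Subgroup.closure_le _).2 ?_
  rintro g ⟨i, j, c, hij, hg⟩
  rw [show g = transvectionUnit i j hij c from Units.ext hg]
  exact h i j hij c

theorem diagonalUnit_conj (d : Fin n → Dˣ) {i j : Fin n} (hij : i ≠ j) (c : D) :
    diagonalUnit d * transvectionUnit i j hij c * (diagonalUnit d)⁻¹ =
      transvectionUnit i j hij (d i * c * ((d j)⁻¹ : Dˣ)) := by
  rw [mul_inv_eq_iff_eq_mul]
  refine GeneralLinearGroup.ext_mulVec fun v => ?_
  simp only [mul_mulVec_eq, transvectionUnit_mulVec, diagonalUnit_mulVec]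
  ext k
  rcases eq_or_ne k i with rfl | hk
  · simp [mul_add, mul_assoc]
  · simp [hk]

/-- Whitehead's factorisation `w(a) w(-1)`, where `w(a)` is the monomial block with rows `(0, a)`
and `(-a⁻¹, 0)`, itself a product of three transvections. -/
theorem diagonalUnit_mem_skewSL {i j : Fin n} (hij : i ≠ j) (a : Dˣ) :
    diagonalUnit (Pi.mulSingle i a * Pi.mulSingle j a⁻¹) ∈ skewSL n D := by
  have key : diagonalUnit (Pi.mulSingle i a * Pi.mulSingle j a⁻¹) =
      transvectionUnit i j hij (a : D) * transvectionUnit j i hij.symm (-(a⁻¹ : Dˣ) : D) *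
      transvectionUnit i j hij (a : D) * (transvectionUnit i j hij (-1) *
      transvectionUnit j i hij.symm 1 * transvectionUnit i j hij (-1)) := by
    refine GeneralLinearGroup.ext_mulVec fun v => ?_
    simp only [mul_mulVec_eq, transvectionUnit_mulVec, diagonalUnit_mulVec]
    ext k
    rcases eq_or_ne k i with rfl | hk
    · simp [hij, hij.symm, mul_add]
    · rcases eq_or_ne k j with rfl | hk'
      · simp [hij, hij.symm, mul_add]
      · simp [hk, hk']
  rw [key]
  repeat' first | exact transvectionUnit_mem_skewSL _ _ | refine mul_mem ?_ ?_

/-! ### Row reduction and generation of `GL_n(D)`. -/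

/-- Subtracting multiples of row `p` from the other rows clears a column vector. -/
theorem exists_clear_column (p : Fin n) (v : Fin n → D) (hv : v p ≠ 0) (s : Finset (Fin n))
    (hs : p ∉ s) : ∃ g ∈ skewSL n D,
      (∀ w : Fin n → D, w p = 0 → (g : Matrix (Fin n) (Fin n) D) *ᵥ w = w) ∧
      (g : Matrix (Fin n) (Fin n) D) *ᵥ v = fun k => if k ∈ s then 0 else v k := by
  induction s using Finset.induction_on with
  | empty => exact ⟨1, one_mem _, by simp, by simp⟩
  | insert i s his ih =>
    obtain ⟨hpi, hps⟩ : p ≠ i ∧ p ∉ s := by simpa using hs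
    obtain ⟨g, hg, hgw, hgv⟩ := ih hps
    refine ⟨transvectionUnit i p hpi.symm (-(v i * (v p)⁻¹)) * g,
      mul_mem (transvectionUnit_mem_skewSL _ _) hg, fun w hw => ?_, ?_⟩
    · rw [mul_mulVec_eq, hgw w hw, transvectionUnit_mulVec]
      simp [hw]
    · rw [mul_mulVec_eq, hgv, transvectionUnit_mulVec]
      ext k
      rcases eq_or_ne k i with rfl | hk
      · simp [his, hps, hv]
      · simp [hk]

/-- The clause on `w` keeps basis vectors that are already in place fixed during later reductions.
-/
theorem exists_mulVec_eq_single (p : Fin n) (v : Fin n → D) (hv : v p ≠ 0) : ∃ g ∈ skewSL n D,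
      (∀ w : Fin n → D, w p = 0 → (g : Matrix (Fin n) (Fin n) D) *ᵥ w = w) ∧
      (g : Matrix (Fin n) (Fin n) D) *ᵥ v = Pi.single p (v p) := by
  obtain ⟨g, hg, hgw, hgv⟩ := exists_clear_column p v hv {p}ᶜ (by simp)
  refine ⟨g, hg, hgw, hgv.trans ?_⟩
  ext k
  rcases eq_or_ne k p with rfl | hk
  · simp
  · simp [hk]

/-- If `v j ≠ 0`, some element of `SL_n(D)` makes the coordinate `p` non-zero without moving the
vectors with vanishing coordinate `j`. -/
theorem exists_mulVec_apply_ne_zero {p j : Fin n} (v : Fin n → D) (hv : v j ≠ 0) :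
    ∃ g ∈ skewSL n D,
      (∀ w : Fin n → D, w j = 0 → (g : Matrix (Fin n) (Fin n) D) *ᵥ w = w) ∧
      ((g : Matrix (Fin n) (Fin n) D) *ᵥ v) p ≠ 0 := by
  by_cases hp : v p = 0
  · have hpj : p ≠ j := by rintro rfl; exact hv hp
    refine ⟨transvectionUnit p j hpj 1, transvectionUnit_mem_skewSL _ _, fun w hw => ?_, ?_⟩
    · rw [transvectionUnit_mulVec]; simp [hw]
    · rw [transvectionUnit_mulVec]; simp [hp, hv]
  · exact ⟨1, one_mem _, by simp, by simpa using hp⟩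

theorem mulVec_injective_unit (g : GeneralLinearGroup (Fin n) D) :
    Function.Injective fun v : Fin n → D => (g : Matrix (Fin n) (Fin n) D) *ᵥ v := by
  intro v w h
  have := congrArg (fun u => ((g⁻¹ : GeneralLinearGroup (Fin n) D) : Matrix (Fin n) (Fin n) D) *ᵥ u) h
  simpa [mulVec_mulVec] using this

/-- `GL_n(D)` is generated by `SL_n(D)` and the diagonal matrices with one non-trivial entry. -/
theorem skewSL_sup_diagonal_eq_top :
    skewSL n D ⊔ Subgroup.closure
      {g | ∃ (i : Fin n) (a : Dˣ), g = diagonalUnit (Pi.mulSingle i a)} = ⊤ := by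
  set H := skewSL n D ⊔ Subgroup.closure
      {g | ∃ (i : Fin n) (a : Dˣ), g = diagonalUnit (Pi.mulSingle i a)} with hH
  have hS : skewSL n D ≤ H := le_sup_left
  have hd : ∀ (i : Fin n) (a : Dˣ), diagonalUnit (Pi.mulSingle i a) ∈ H := fun i a =>
    (le_sup_right : _ ≤ H) (Subgroup.subset_closure ⟨i, a, rfl⟩)
  refine (Subgroup.eq_top_iff' _).2 fun g => ?_
  have main : ∀ s : Finset (Fin n), ∃ h ∈ H, ∀ k ∈ s,
      ((h * g : GeneralLinearGroup (Fin n) D) : Matrix (Fin n) (Fin n) D) *ᵥ Pi.single k 1 =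
        Pi.single k 1 := by
    intro s
    induction s using Finset.induction_on with
    | empty => exact ⟨1, one_mem _, by simp⟩
    | insert k s hk ih =>
      obtain ⟨h, hh, hs⟩ := ih
      set w := ((h * g : GeneralLinearGroup (Fin n) D) : Matrix (Fin n) (Fin n) D) *ᵥ Pi.single k 1 with hw
      -- A pivot outside `s` exists: otherwise `w` is a combination of fixed basis vectors, so `h *
      -- g` sends both `w` and `e_k` to `w`, forcing `w = e_k` although `w k = 0`. Scalars act on
      -- the right, hence `MulOpposite.op`.
      obtain ⟨j, hj, hwj⟩ : ∃ j, j ∉ s ∧ w j ≠ 0 := by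
        by_contra! hcon
        have hsum : w = ((h * g : GeneralLinearGroup (Fin n) D) : Matrix (Fin n) (Fin n) D) *ᵥ w := by
          have h1 : w = ∑ j ∈ s, MulOpposite.op (w j) • Pi.single j (1 : D) := by
            ext l
            by_cases hl : l ∈ s
            · simp [Finset.sum_apply, Pi.single_apply, hl]
            · simp [Finset.sum_apply, Pi.single_apply, hl, hcon l hl]
          conv_rhs => rw [h1, mulVec_sum]
          conv_lhs => rw [h1]
          refine Finset.sum_congr rfl fun j hj => ?_
          rw [mulVec_smul, hs j hj]
        have h2 := mulVec_injective_unit (h * g) (hw.symm.trans hsum)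
        have h3 := hcon k hk
        rw [← h2] at h3
        simp at h3
      obtain ⟨g₁, hg₁, hg₁w, hg₁v⟩ := exists_mulVec_apply_ne_zero (p := k) w hwj
      obtain ⟨g₂, hg₂, hg₂w, hg₂v⟩ := exists_mulVec_eq_single k _ hg₁v
      set a := Units.mk0 _ hg₁v
      refine ⟨diagonalUnit (Pi.mulSingle k a⁻¹) * (g₂ * (g₁ * h)),
        mul_mem (hd _ _) (mul_mem (hS hg₂) (mul_mem (hS hg₁) hh)), fun l hl => ?_⟩
      have hassoc : diagonalUnit (Pi.mulSingle k a⁻¹) * (g₂ * (g₁ * h)) * g =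
          diagonalUnit (Pi.mulSingle k a⁻¹) * (g₂ * (g₁ * (h * g))) := by group
      rw [hassoc, mul_mulVec_eq, mul_mulVec_eq, mul_mulVec_eq]
      rcases Finset.mem_insert.1 hl with rfl | hls
      · rw [← hw, hg₂v, diagonalUnit_mulVec]
        ext m
        rcases eq_or_ne m l with rfl | hm
        · simp [a, hg₁v]
        · simp [hm]
      · have hlk : l ≠ k := by rintro rfl; exact hk hls
        have hlj : l ≠ j := by rintro rfl; exact hj hls
        rw [hs l hls, hg₁w _ (by simp [hlj.symm]), hg₂w _ (by simp [hlk.symm]),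
          diagonalUnit_mulVec]
        ext m
        rcases eq_or_ne m k with rfl | hm
        · simp [hlk.symm]
        · simp [hm]
  obtain ⟨h, hh, hs⟩ := main Finset.univ
  have : h * g = 1 := by
    refine Units.ext (Matrix.ext fun i j => ?_)
    have := congrFun (hs j (Finset.mem_univ j)) i
    simpa [Matrix.one_apply, Pi.single_apply] using this
  rw [eq_inv_of_mul_eq_one_right this]
  exact inv_mem hh

/-! ### Normality of `SL_n(D)` and of its overgroups. -/

instance skewSL_normal : (skewSL n D).Normal := by
  rw [← Subgroup.normalizer_eq_top_iff, eq_top_iff, ← skewSL_sup_diagonal_eq_top (n := n) (D := D)]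
  refine sup_le Subgroup.le_normalizer ((Subgroup.closure_le _).2 ?_)
  rintro _ ⟨k, a, rfl⟩
  have hconj : ∀ (d : Fin n → Dˣ), ∀ x ∈ skewSL n D,
      diagonalUnit d * x * (diagonalUnit d)⁻¹ ∈ skewSL n D := by
    intro d x hx
    have : skewSL n D ≤ (skewSL n D).comap (MulAut.conj (diagonalUnit d)).toMonoidHom :=
      skewSL_le_iff.2 fun i j hij c => by
        simpa [diagonalUnit_conj] using transvectionUnit_mem_skewSL hij _
    simpa using this hx
  refine Subgroup.mem_normalizer_iff.2 fun x => ⟨hconj _ x, fun hx => ?_⟩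
  have := hconj (Pi.mulSingle k a)⁻¹ _ hx
  rw [map_inv] at this
  simpa [mul_assoc] using this

/-- Every group quotient of `GL_n(D)` that kills `SL_n(D)` is commutative. -/
theorem commute_map_of_skewSL_le_ker (hn : 2 ≤ n) {Q : Type*} [Group Q]
    (π : GeneralLinearGroup (Fin n) D →* Q) (hπ : skewSL n D ≤ π.ker)
    (x y : GeneralLinearGroup (Fin n) D) : Commute (π x) (π y) := by
  have hgen : ∀ C : Subgroup Q,
      (∀ (i : Fin n) (a : Dˣ), π (diagonalUnit (Pi.mulSingle i a)) ∈ C) → ∀ g, π g ∈ C := by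
    intro C hC g
    have : (⊤ : Subgroup (GeneralLinearGroup (Fin n) D)) ≤ C.comap π := by
      rw [← skewSL_sup_diagonal_eq_top (n := n) (D := D)]
      refine sup_le (fun s hs => ?_) ((Subgroup.closure_le _).2 ?_)
      · rw [Subgroup.mem_comap, MonoidHom.mem_ker.1 (hπ hs)]
        exact one_mem _
      · rintro _ ⟨i, a, rfl⟩
        exact hC i a
    exact this (Subgroup.mem_top g)
  -- Modulo `SL_n(D)` the position of the diagonal entry is irrelevant.
  have hmove : ∀ (i j : Fin n) (a : Dˣ),
      π (diagonalUnit (Pi.mulSingle i a)) = π (diagonalUnit (Pi.mulSingle j a)) := by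
    intro i j a
    rcases eq_or_ne i j with rfl | hij
    · rfl
    have := MonoidHom.mem_ker.1 (hπ (diagonalUnit_mem_skewSL hij a))
    rw [map_mul, map_mul, Pi.mulSingle_inv, map_inv, map_inv] at this
    exact mul_inv_eq_one.1 this
  let i₀ : Fin n := ⟨0, by omega⟩
  let i₁ : Fin n := ⟨1, by omega⟩
  have h01 : i₀ ≠ i₁ := by simp [i₀, i₁]
  have hcomm : ∀ (i j : Fin n) (a b : Dˣ), Commute (π (diagonalUnit (Pi.mulSingle i a)))
      (π (diagonalUnit (Pi.mulSingle j b))) := by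
    intro i j a b
    -- Placed at different positions the two matrices commute, even if `a` and `b` do not.
    rw [hmove i i₀, hmove j i₁]
    exact ((Pi.mulSingle_commute (f := fun _ => Dˣ) h01 a b).map diagonalUnit).map π
  have hone : ∀ (i : Fin n) (a : Dˣ) (g : GeneralLinearGroup (Fin n) D),
      Commute (π g) (π (diagonalUnit (Pi.mulSingle i a))) := fun i a g =>
    Subgroup.mem_centralizer_singleton_iff.1
      (hgen (Subgroup.centralizer {π (diagonalUnit (Pi.mulSingle i a))})
        (fun j b => Subgroup.mem_centralizer_singleton_iff.2 (hcomm j i b a)) g)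
  exact Subgroup.mem_centralizer_singleton_iff.1 (hgen (Subgroup.centralizer {π y})
    (fun j b => Subgroup.mem_centralizer_singleton_iff.2 (hone j b y).symm) x)

theorem normal_of_skewSL_le (hn : 2 ≤ n) {N : Subgroup (GeneralLinearGroup (Fin n) D)}
    (h : skewSL n D ≤ N) : N.Normal := by
  refine ⟨fun x hx g => ?_⟩
  have h1 : g * x * g⁻¹ * x⁻¹ ∈ skewSL n D := by
    have := commute_map_of_skewSL_le_ker hn (QuotientGroup.mk' (skewSL n D))
      (QuotientGroup.ker_mk' _).ge g x
    rw [← QuotientGroup.ker_mk' (skewSL n D), MonoidHom.mem_ker, map_mul, map_mul, map_mul,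
      map_inv, map_inv, this.eq]
    group
  simpa using mul_mem (h h1) hx

end SkewLinearGroup

/-! ### Auxiliary facts on additive subgroups, generators and finite index. -/

/-- Differencing `a * b * a - b` between `a + 1` and `a` gives `l(a) = a * b + b * a + b`, affine in
`a`, and `l(a) + l(c) - l(a + c) = b`. Infinitude lets `a`, `c` and `a + c` avoid `0` and `-1`. -/
theorem AddSubgroup.eq_top_of_mul_mul_sub_mem {D : Type*} [DivisionRing D] [Infinite D]
    (A : AddSubgroup D) (hA : ∀ a : D, a ≠ 0 → ∀ b, a * b * a - b ∈ A) : A = ⊤ := by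
  have h1 : ∀ a : D, a ≠ 0 → a ≠ -1 → ∀ b, a * b + b * a + b ∈ A := by
    intro a ha ha' b
    have := sub_mem (hA (a + 1) (fun h => ha' (eq_neg_of_add_eq_zero_left h)) b) (hA a ha b)
    convert this using 1
    noncomm_ring
  refine (AddSubgroup.eq_top_iff' A).2 fun b => ?_
  classical
  obtain ⟨a, ha⟩ := Infinite.exists_notMem_finset ({0, -1} : Finset D)
  obtain ⟨c, hc⟩ := Infinite.exists_notMem_finset ({0, -1, -a, -1 - a} : Finset D)
  simp only [Finset.mem_insert, Finset.mem_singleton, not_or] at ha hc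
  have hac : a + c ≠ 0 := fun h => hc.2.2.1 (eq_neg_of_add_eq_zero_right h)
  have hac' : a + c ≠ -1 := fun h => hc.2.2.2 (eq_sub_of_add_eq' h)
  have := sub_mem (add_mem (h1 a ha.1 ha.2 b) (h1 c hc.1 hc.2.1 b)) (h1 _ hac hac' b)
  convert this using 1
  noncomm_ring

/-- If `K` is normalised by the subgroup generated by `S` and the elements of `S` commute
modulo `K`, then that subgroup is abelian modulo `K`. -/
theorem Subgroup.commutator_mem_of_closure {G : Type*} [Group G] (S : Set G) (K : Subgroup G)
    (hK : ∀ s ∈ closure S, ∀ k ∈ K, s * k * s⁻¹ ∈ K)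
    (hS : ∀ s ∈ S, ∃ u ∈ closure S, s * u⁻¹ ∈ K ∧ ∀ t ∈ S, ∃ v ∈ closure S,
      t * v⁻¹ ∈ K ∧ Commute u v) {x y : G} (hx : x ∈ closure S) (hy : y ∈ closure S) :
    x * y * x⁻¹ * y⁻¹ ∈ K := by
  have hN : (K.subgroupOf (closure S)).Normal :=
    ⟨fun k hk s => hK s s.2 k hk⟩
  let π := QuotientGroup.mk' (K.subgroupOf (closure S))
  have hker : π.ker = K.subgroupOf (closure S) := QuotientGroup.ker_mk' _
  generalize π = π at hker
  have hπ : ∀ a b : closure S, (a : G) * (b : G)⁻¹ ∈ K → π a = π b := by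
    intro a b h
    rw [← mul_inv_eq_one, ← map_inv, ← map_mul, ← MonoidHom.mem_ker, hker]
    exact h
  have hgen : ∀ C : Subgroup (closure S ⧸ K.subgroupOf (closure S)),
      (∀ s : closure S, (s : G) ∈ S → π s ∈ C) → ∀ s, π s ∈ C := by
    intro C hC s
    have : (⊤ : Subgroup (closure S)) ≤ C.comap π := by
      rw [← closure_closure_coe_preimage, closure_le]
      exact fun s hs => hC s hs
    exact this (mem_top s)
  have h1 : ∀ s t : closure S, (s : G) ∈ S → (t : G) ∈ S → Commute (π s) (π t) := by
    intro s t hs ht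
    obtain ⟨u, hu, hsu, H⟩ := hS s hs
    obtain ⟨v, hv, htv, huv⟩ := H t ht
    rw [hπ s ⟨u, hu⟩ hsu, hπ t ⟨v, hv⟩ htv]
    exact Commute.map (show Commute (⟨u, hu⟩ : closure S) ⟨v, hv⟩ from Subtype.ext huv.eq) π
  have h2 : ∀ s t : closure S, (t : G) ∈ S → Commute (π s) (π t) := fun s t ht =>
    mem_centralizer_singleton_iff.1 (hgen (centralizer {π t})
      (fun r hr => mem_centralizer_singleton_iff.2 (h1 r t hr ht)) s)
  have h3 : Commute (π ⟨x, hx⟩) (π ⟨y, hy⟩) :=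
    mem_centralizer_singleton_iff.1 (hgen (centralizer {π ⟨y, hy⟩})
      (fun r hr => mem_centralizer_singleton_iff.2 (h2 ⟨y, hy⟩ r hr).symm) _)
  have : (⟨x, hx⟩ * ⟨y, hy⟩ * ⟨x, hx⟩⁻¹ * ⟨y, hy⟩⁻¹ : closure S) ∈ π.ker := by
    rw [MonoidHom.mem_ker, map_mul, map_mul, map_mul, map_inv, map_inv, h3.eq]
    group
  rw [hker] at this
  exact this

/-- `K` is the normal core in `S` of `L ⊓ S`. -/
theorem Subgroup.exists_normalized_of_relIndex_ne_zero {G : Type*} [Group G] {L S : Subgroup G}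
    (h : L.relIndex S ≠ 0) :
    ∃ K ≤ L, (∀ s ∈ S, ∀ k ∈ K, s * k * s⁻¹ ∈ K) ∧ K.relIndex S ≠ 0 := by
  have hf : (L.subgroupOf S).FiniteIndex := ⟨h⟩
  have hfc : (L.subgroupOf S).normalCore.FiniteIndex := inferInstance
  refine ⟨(L.subgroupOf S).normalCore.map S.subtype, ?_, ?_, ?_⟩
  · rintro _ ⟨x, hx, rfl⟩
    exact mem_subgroupOf.1 (normalCore_le (L.subgroupOf S) hx)
  · rintro s hs _ ⟨k, hk, rfl⟩
    exact ⟨⟨s, hs⟩ * k * ⟨s, hs⟩⁻¹, (normalCore_normal (L.subgroupOf S)).conj_mem k hk _, rfl⟩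
  · rw [relIndex, subgroupOf, comap_map_eq_self_of_injective S.subtype_injective]
    exact hfc.index_ne_zero

theorem Subgroup.exists_ne_inv_mul_mem_of_relIndex_ne_zero {G : Type*} [Group G]
    {K S : Subgroup G} (h : K.relIndex S ≠ 0) {X : Type*} [Infinite X] (f : X → G)
    (hf : ∀ x, f x ∈ S) : ∃ x y, x ≠ y ∧ (f x)⁻¹ * f y ∈ K := by
  have hfin : (K.subgroupOf S).FiniteIndex := ⟨h⟩
  obtain ⟨x, y, hxy, h⟩ := Finite.exists_ne_map_eq_of_infinite fun x =>
    (QuotientGroup.mk ⟨f x, hf x⟩ : S ⧸ K.subgroupOf S)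
  have h1 := QuotientGroup.eq.1 h
  exact ⟨x, y, hxy, mem_subgroupOf.1 h1⟩

section SkewLinearGroup

open Matrix

variable {D : Type*} [DivisionRing D] {n : ℕ}

/-! ### Non-central subgroups normalised by `SL_n(D)`. -/

/-- Testing on `e_j` makes `g` diagonal; testing on `e_i + e_j c` gives `a j * c = c * a i`, so the
diagonal entries are equal and central. -/
theorem mem_center_of_mulVec_collinear (hn : 2 ≤ n) (g : GeneralLinearGroup (Fin n) D)
    (hg : ∀ v : Fin n → D, ∃ a : D,
      (g : Matrix (Fin n) (Fin n) D) *ᵥ v = MulOpposite.op a • v) :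
    g ∈ Subgroup.center (GeneralLinearGroup (Fin n) D) := by
  choose a ha using fun j => hg (Pi.single j 1)
  have hgd : ∀ i j, (g : Matrix (Fin n) (Fin n) D) i j = if i = j then a i else 0 := by
    intro i j
    have := congrFun (ha j) i
    rcases eq_or_ne i j with rfl | hij
    · simpa using this
    · simpa [hij] using this
  have hgv : ∀ v i, ((g : Matrix (Fin n) (Fin n) D) *ᵥ v) i = a i * v i := by
    intro v i
    simp [mulVec, dotProduct, hgd]
  have h1 : ∀ i j, i ≠ j → ∀ c, a j * c = c * a i := by
    intro i j hij c
    obtain ⟨b, hb⟩ := hg (Pi.single i 1 + Pi.single j c)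
    have hi := congrFun hb i
    have hj := congrFun hb j
    rw [hgv] at hi hj
    simp [hij, hij.symm] at hi hj
    rw [hj, hi]
  have h2 : ∀ i j c, a i * c = c * a j := by
    intro i j c
    rcases eq_or_ne i j with rfl | hij
    · have : Nontrivial (Fin n) := Fin.nontrivial_iff_two_le.2 hn
      obtain ⟨j, hj⟩ := exists_ne i
      have h := h1 i j hj.symm 1
      rw [mul_one, one_mul] at h
      rw [← h1 i j hj.symm c, h]
    · exact h1 j i hij.symm c
  refine Subgroup.mem_center_iff.2 fun x => Units.ext (Matrix.ext fun i j => ?_)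
  simp [Matrix.mul_apply, hgd, h2 i j]

/-- `SL_n(D)` is transitive on pairs of distinct lines. -/
theorem exists_mulVec_eq_single_pair {i j : Fin n} (hij : i ≠ j) (v w : Fin n → D)
    (hv : v ≠ 0) (hw : ∀ a : D, w ≠ MulOpposite.op a • v) :
    ∃ s ∈ skewSL n D, ∃ a b : D, a ≠ 0 ∧ b ≠ 0 ∧
      (s : Matrix (Fin n) (Fin n) D) *ᵥ v = Pi.single i a ∧
      (s : Matrix (Fin n) (Fin n) D) *ᵥ w = Pi.single j b := by
  obtain ⟨l, hl⟩ := Function.ne_iff.1 hv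
  obtain ⟨g₁, hg₁, -, hv₁⟩ := exists_mulVec_apply_ne_zero (p := i) v hl
  obtain ⟨g₂, hg₂, -, hv₂⟩ := exists_mulVec_eq_single i _ hv₁
  rw [← mul_mulVec_eq] at hv₂
  set a := ((g₁ : Matrix (Fin n) (Fin n) D) *ᵥ v) i
  set w' := ((g₂ * g₁ : GeneralLinearGroup (Fin n) D) : Matrix (Fin n) (Fin n) D) *ᵥ w with hw'
  -- If `w'` were supported at `i`, then `w` would be a multiple of `v`. A pivot off `i` allows `w'`
  -- to be reduced while `e_i` stays fixed.
  obtain ⟨m, hmi, hm⟩ : ∃ m, m ≠ i ∧ w' m ≠ 0 := by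
    by_contra! hcon
    refine hw (a⁻¹ * w' i) (mulVec_injective_unit (g₂ * g₁) ?_)
    change w' = _ *ᵥ _
    rw [mulVec_smul, hv₂]
    ext k
    rcases eq_or_ne k i with rfl | hk
    · simp [hv₁, a]
    · simp [hk, hcon k hk]
  obtain ⟨g₃, hg₃, hfix₃, hw₃⟩ := exists_mulVec_apply_ne_zero (p := j) w' hm
  obtain ⟨g₄, hg₄, hfix₄, hw₄⟩ := exists_mulVec_eq_single j _ hw₃
  refine ⟨g₄ * (g₃ * (g₂ * g₁)), mul_mem hg₄ (mul_mem hg₃ (mul_mem hg₂ hg₁)), a, _, hv₁, hw₃,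
    ?_, ?_⟩
  · rw [mul_mulVec_eq, mul_mulVec_eq, hv₂, hfix₃ _ (by simp [hmi]), hfix₄ _ (by simp [hij.symm])]
  · rw [mul_mulVec_eq, mul_mulVec_eq, ← hw', hw₄]

/-- Some `g ∈ K` moves a line `v`; if `s ∈ SL_n(D)` takes the lines of `v` and `g v` to those of
`e_i` and `e_j`, then `s * g * s⁻¹` works. -/
theorem exists_mem_mulVec_single (hn : 2 ≤ n) {K : Subgroup (GeneralLinearGroup (Fin n) D)}
    (hK : ∀ s ∈ skewSL n D, ∀ k ∈ K, s * k * s⁻¹ ∈ K)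
    (hc : ¬ K ≤ Subgroup.center (GeneralLinearGroup (Fin n) D)) (i j : Fin n) :
    ∃ k ∈ K, ∃ a : D, a ≠ 0 ∧
      (k : Matrix (Fin n) (Fin n) D) *ᵥ Pi.single i 1 = MulOpposite.op a • Pi.single j 1 := by
  rcases eq_or_ne i j with rfl | hij
  · exact ⟨1, one_mem _, 1, one_ne_zero, by
      rw [Units.val_one, one_mulVec, MulOpposite.op_one, one_smul]⟩
  obtain ⟨g, hg, hgc⟩ := SetLike.not_le_iff_exists.1 hc
  obtain ⟨v, hv⟩ : ∃ v : Fin n → D, ∀ a : D,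
      (g : Matrix (Fin n) (Fin n) D) *ᵥ v ≠ MulOpposite.op a • v := by
    by_contra! hcon
    exact hgc (mem_center_of_mulVec_collinear hn g hcon)
  have hv0 : v ≠ 0 := by
    rintro rfl
    exact hv 0 (by simp)
  obtain ⟨s, hs, a, b, ha, hb, hsv, hsw⟩ := exists_mulVec_eq_single_pair hij v _ hv0 hv
  refine ⟨s * g * s⁻¹, hK s hs g hg, b * a⁻¹, mul_ne_zero hb (inv_ne_zero ha), ?_⟩
  have h1 : (Pi.single i 1 : Fin n → D) = MulOpposite.op a⁻¹ • Pi.single i a := by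
    ext k
    rcases eq_or_ne k i with rfl | hk
    · simp [ha]
    · simp [hk]
  have h2 : ((s⁻¹ : GeneralLinearGroup (Fin n) D) : Matrix (Fin n) (Fin n) D) *ᵥ
      Pi.single i a = v := by
    rw [← hsv, ← mul_mulVec_eq, inv_mul_cancel]
    simp
  rw [h1, mulVec_smul, mul_mulVec_eq, mul_mulVec_eq, h2, hsw]
  ext k
  rcases eq_or_ne k j with rfl | hk
  · simp
  · simp [hk]

/-- `g` is a transvection in the direction `v`: it is `w ↦ w + v f(w)` with `f(v) = 0`. -/
def IsTransvectionAlong (v : Fin n → D) (g : GeneralLinearGroup (Fin n) D) : Prop :=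
  ∃ f : (Fin n → D) → D, (∀ (w : Fin n → D) (d : D), f (w + MulOpposite.op d • v) = f w) ∧
    ∀ w : Fin n → D, (g : Matrix (Fin n) (Fin n) D) *ᵥ w = w + MulOpposite.op (f w) • v

/-- Neither `f` nor `e` notices multiples of `v`, so both products add `f w` and `e w` times `v`. -/
theorem IsTransvectionAlong.commute {v : Fin n → D} {g h : GeneralLinearGroup (Fin n) D}
    (hg : IsTransvectionAlong v g) (hh : IsTransvectionAlong v h) : Commute g h := by
  obtain ⟨f, hf, hg⟩ := hg
  obtain ⟨e, he, hh⟩ := hh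
  refine GeneralLinearGroup.ext_mulVec fun w => ?_
  rw [mul_mulVec_eq, mul_mulVec_eq, hh, hg, hg, hh, hf, he, add_right_comm]

theorem isTransvectionAlong_transvectionUnit {i j : Fin n} (hij : i ≠ j) (c : D) :
    IsTransvectionAlong (Pi.single i 1) (transvectionUnit i j hij c) := by
  refine ⟨fun w => c * w j, fun w d => by simp [hij.symm], fun w => ?_⟩
  rw [transvectionUnit_mulVec]
  ext k
  rcases eq_or_ne k i with rfl | hk
  · simp
  · simp [hk]

theorem IsTransvectionAlong.conj {v w : Fin n → D} {g k : GeneralLinearGroup (Fin n) D} {a : D}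
    (ha : a ≠ 0) (hk : (k : Matrix (Fin n) (Fin n) D) *ᵥ v = MulOpposite.op a • w)
    (hg : IsTransvectionAlong w g) : IsTransvectionAlong v (k⁻¹ * g * k) := by
  obtain ⟨f, hf, hg⟩ := hg
  refine ⟨fun u => a⁻¹ * f ((k : Matrix (Fin n) (Fin n) D) *ᵥ u), fun u d => ?_, fun u => ?_⟩
  · simp only [mulVec_add, mulVec_smul, hk, smul_smul, ← MulOpposite.op_mul, hf]
  · apply mulVec_injective_unit k
    simp only [← mul_mulVec_eq]
    rw [show k * (k⁻¹ * g * k) = g * k by group, mul_mulVec_eq, hg, mulVec_add, mulVec_smul, hk,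
      smul_smul, ← MulOpposite.op_mul, mul_inv_cancel_left₀ ha]

/-- A non-central subgroup of `GL_n(D)` normalised by `SL_n(D)` contains `SL_n(D)`. -/
theorem skewSL_le_of_normalized [Infinite D] (hn : 2 ≤ n)
    {K : Subgroup (GeneralLinearGroup (Fin n) D)}
    (hK : ∀ s ∈ skewSL n D, ∀ k ∈ K, s * k * s⁻¹ ∈ K)
    (hc : ¬ K ≤ Subgroup.center (GeneralLinearGroup (Fin n) D)) : skewSL n D ≤ K := by
  let i₀ : Fin n := ⟨0, by omega⟩
  -- Conjugating by `k ∈ K` does not change `s` modulo `K`, but turns its direction into `e_{i₀}`.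
  have hgen : ∀ s ∈ {g : GeneralLinearGroup (Fin n) D | ∃ (i j : Fin n) (c : D), i ≠ j ∧
      (g : Matrix (Fin n) (Fin n) D) = 1 + Matrix.single i j c}, ∃ u ∈ skewSL n D,
      s * u⁻¹ ∈ K ∧ IsTransvectionAlong (Pi.single i₀ 1) u := by
    rintro s ⟨i, j, c, hij, hs⟩
    obtain rfl : s = transvectionUnit i j hij c := Units.ext hs
    obtain ⟨k, hk, a, ha, hka⟩ := exists_mem_mulVec_single hn hK hc i₀ i
    have hs := transvectionUnit_mem_skewSL hij c
    refine ⟨k⁻¹ * transvectionUnit i j hij c * k, ?_, ?_,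
      (isTransvectionAlong_transvectionUnit hij c).conj ha hka⟩
    · simpa using skewSL_normal.conj_mem _ hs k⁻¹
    · have := mul_mem (hK _ hs _ (inv_mem hk)) hk
      convert this using 1
      group
  have hcomm : ∀ x ∈ skewSL n D, ∀ y ∈ skewSL n D, x * y * x⁻¹ * y⁻¹ ∈ K := by
    intro x hx y hy
    refine Subgroup.commutator_mem_of_closure _ K hK (fun s hs => ?_) hx hy
    obtain ⟨u, hu, hsu, hu'⟩ := hgen s hs
    refine ⟨u, hu, hsu, fun t ht => ?_⟩
    obtain ⟨v, hv, htv, hv'⟩ := hgen t ht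
    exact ⟨v, hv, htv, hu'.commute hv'⟩
  refine skewSL_le_iff.2 fun i j hij c => ?_
  let A : AddSubgroup D :=
    { carrier := {c | transvectionUnit i j hij c ∈ K}
      zero_mem' := by simp [transvectionUnit_zero]
      add_mem' := fun {a b} ha hb => by
        simpa [transvectionUnit_add] using mul_mem ha hb
      neg_mem' := fun {a} ha => by
        simpa [transvectionUnit_neg] using ha }
  have hA : A = ⊤ := by
    refine A.eq_top_of_mul_mul_sub_mem fun a ha b => ?_
    change transvectionUnit i j hij _ ∈ K
    -- The commutator of `diag(a, a⁻¹)` with the transvection of parameter `b` has parameter `a * b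
    -- * a - b`.
    have := hcomm _ (diagonalUnit_mem_skewSL hij (Units.mk0 a ha)) _
      (transvectionUnit_mem_skewSL hij b)
    rw [diagonalUnit_conj, ← transvectionUnit_neg, ← transvectionUnit_add] at this
    simpa [hij, hij.symm, sub_eq_add_neg] using this
  have : c ∈ A := by rw [hA]; trivial
  exact this

/-! ### Finite index and almost subnormal series. -/

theorem transvectionUnit_notMem_center {i j : Fin n} (hij : i ≠ j) {c : D} (hc : c ≠ 0) :
    transvectionUnit i j hij c ∉ Subgroup.center (GeneralLinearGroup (Fin n) D) := by
  intro h
  have h1 := congrArg (fun g : GeneralLinearGroup (Fin n) D =>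
    ((g : Matrix (Fin n) (Fin n) D) *ᵥ Pi.single j 1) j)
    (Subgroup.mem_center_iff.1 h (transvectionUnit j i hij.symm 1))
  simp only [mul_mulVec_eq, transvectionUnit_mulVec] at h1
  simp [hij, hij.symm, hc] at h1

theorem not_le_center_of_skewSL_le (hn : 2 ≤ n) {N : Subgroup (GeneralLinearGroup (Fin n) D)}
    (h : skewSL n D ≤ N) : ¬ N ≤ Subgroup.center (GeneralLinearGroup (Fin n) D) := by
  have h01 : (⟨0, by omega⟩ : Fin n) ≠ ⟨1, by omega⟩ := by simp
  exact fun hN => transvectionUnit_notMem_center h01 (one_ne_zero (α := D))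
    (hN (h (transvectionUnit_mem_skewSL h01 1)))

/-- By pigeonhole two of the infinitely many `1 + c e_{01}` are congruent modulo the core, which
thus contains a non-trivial transvection and is non-central. -/
theorem skewSL_le_of_relIndex_ne_zero [Infinite D] (hn : 2 ≤ n)
    {L : Subgroup (GeneralLinearGroup (Fin n) D)} (h : L.relIndex (skewSL n D) ≠ 0) :
    skewSL n D ≤ L := by
  obtain ⟨K, hKL, hK, hfin⟩ := Subgroup.exists_normalized_of_relIndex_ne_zero h
  refine le_trans (skewSL_le_of_normalized hn hK fun hcen => ?_) hKL
  have h01 : (⟨0, by omega⟩ : Fin n) ≠ ⟨1, by omega⟩ := by simp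
  obtain ⟨c, d, hcd, h⟩ := Subgroup.exists_ne_inv_mul_mem_of_relIndex_ne_zero hfin
    (fun c : D => transvectionUnit _ _ h01 c) (transvectionUnit_mem_skewSL h01)
  rw [← transvectionUnit_neg, ← transvectionUnit_add] at h
  exact transvectionUnit_notMem_center h01 (fun h0 => hcd (neg_add_eq_zero.1 h0)) (hcen h)

theorem skewSL_le_of_isAlmostSubnormal [Infinite D] (hn : 2 ≤ n)
    {N : Subgroup (GeneralLinearGroup (Fin n) D)} (hN : IsAlmostSubnormal N)
    (hc : ¬ N ≤ Subgroup.center (GeneralLinearGroup (Fin n) D)) : skewSL n D ≤ N := by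
  obtain ⟨r, H, h0, rfl, hstep⟩ := hN
  have hle : ∀ m i, i + m = r → H r ≤ H i := by
    intro m
    induction m with
    | zero => rintro i rfl; exact le_rfl
    | succ m ih =>
      intro i hi
      exact (ih (i + 1) (by omega)).trans (hstep i (by omega)).1
  -- Every term of the series contains `H r`, so it is non-central, and containment of `SL_n(D)`
  -- passes down the series.
  have main : ∀ i ≤ r, skewSL n D ≤ H i := by
    intro i
    induction i with
    | zero => intro _; rw [h0]; exact le_top
    | succ i ih =>
      intro hi
      have hS := ih (by omega)
      obtain ⟨hsub, hnor | hfin⟩ := hstep i hi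
      · refine skewSL_le_of_normalized hn (fun s hs k hk => ?_)
          fun h => hc ((hle (r - (i + 1)) (i + 1) (by omega)).trans h)
        exact hnor.conj_mem ⟨k, hsub hk⟩ hk ⟨s, hS hs⟩
      · exact skewSL_le_of_relIndex_ne_zero hn fun h =>
          hfin.index_ne_zero (Subgroup.relIndex_eq_zero_of_le_right hS h)
  exact main r le_rfl

end SkewLinearGroup

/-! ### Vertices of the graph and the conclusion. -/

theorem Subgroup.Normal.isAlmostSubnormal {G : Type*} [Group G] {N : Subgroup G}
    (hN : N.Normal) : IsAlmostSubnormal N := by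
  refine ⟨1, fun i => if i = 0 then ⊤ else N, by simp, by simp, fun i hi => ?_⟩
  obtain rfl : i = 0 := by omega
  exact ⟨by simp, Or.inl (by simpa using Subgroup.normal_subgroupOf)⟩

theorem mem_deltaVertexSet_iff {G : Type*} [Group G] {N : Subgroup G} :
    N ∈ deltaVertexSet G ↔ N ≠ ⊤ ∧ ¬ N ≤ Subgroup.center G ∧ IsAlmostSubnormal N := by
  constructor
  · rintro ⟨v, rfl⟩
    exact ⟨v.1.2.2, v.2⟩
  · rintro ⟨h, hc, hN⟩
    exact ⟨⟨⟨N, fun hb => hc (hb ▸ bot_le), h⟩, hc, hN⟩, rfl⟩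

theorem mainTheorem4 {D : Type*} [DivisionRing D] [Infinite D] (n : ℕ) (hn : 2 ≤ n) :
    deltaGraph (Matrix.GeneralLinearGroup (Fin n) D) = ⊤ ∧
    (∀ N : Subgroup (Matrix.GeneralLinearGroup (Fin n) D),
      N ∈ deltaVertexSet (Matrix.GeneralLinearGroup (Fin n) D) ↔
        N ≠ ⊤ ∧ N.Normal ∧ ¬ N ≤ Subgroup.center (Matrix.GeneralLinearGroup (Fin n) D)) ∧
    (∀ N : Subgroup (Matrix.GeneralLinearGroup (Fin n) D),
      N ∈ deltaVertexSet (Matrix.GeneralLinearGroup (Fin n) D) ↔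
        N ≠ ⊤ ∧ skewSL n D ≤ N) := by
  refine ⟨?_, fun N => ?_, fun N => ?_⟩
  · ext v w
    rw [SimpleGraph.top_adj]
    refine ⟨fun h => h.ne, fun h => ⟨fun h' => h (Subtype.ext h'), fun hbot => ?_⟩⟩
    have hle := le_inf (skewSL_le_of_isAlmostSubnormal hn v.2.2 v.2.1)
      (skewSL_le_of_isAlmostSubnormal hn w.2.2 w.2.1)
    exact not_le_center_of_skewSL_le hn hle (hbot.le.trans bot_le)
  · rw [mem_deltaVertexSet_iff]
    exact ⟨fun ⟨h, hc, hN⟩ =>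
      ⟨h, normal_of_skewSL_le hn (skewSL_le_of_isAlmostSubnormal hn hN hc), hc⟩,
      fun ⟨h, hN, hc⟩ => ⟨h, hc, hN.isAlmostSubnormal⟩⟩
  · rw [mem_deltaVertexSet_iff]
    exact ⟨fun ⟨h, hc, hN⟩ => ⟨h, skewSL_le_of_isAlmostSubnormal hn hN hc⟩,
      fun ⟨h, hS⟩ => ⟨h, not_le_center_of_skewSL_le hn hS,
        (normal_of_skewSL_le hn hS).isAlmostSubnormal⟩⟩
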